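/- Let $0<a<\tfrac16$ and let $F:\mathbb R^2\to\mathbb R^2$ be the map $$F(x,y)=(x+2a\sin x+a\sin y,\; y+a\sin x+2a\sin y).$$ Consider the squares $$s_1=\{x-\pi\le y\le x,\ -x\le y\le -x+\pi\},\quad s_2=\{x-\pi\le y\le x,\ -x+\pi\le y\le -x+2\pi\},$$ $$s_3=\{x-2\pi\le y\le x-\pi,\ -x\le y\le -x+\pi\},$$ and let $\gamma^L=W^s(\pi,0)\cap\operatorname{int}(s_1)$, where $W^s(\pi,0)=\{p: F^n(p)\to(\pi,0)\text{ as } n\to+\infty\}$ is the stable manifold of the fixed point $(\pi,0)$. Then: 1. $\gamma^L$ is a heteroclinic curve from $(0,0)$ to $(\pi,0)$: it is the image of an injective continuous curve $c:\mathbb R\to\mathbb R^2$ with $c(t)\to(0,0)$ as $t\to-\infty$ and $c(t)\to(\pi,0)$ as $t\to+\infty$, it satisfies $F(\gamma^L)=\gamma^L$, and every orbit $(X_n)_{n\in\mathbb Z}$ of $F$ with $X_0\in\gamma^L$ satisfies $X_n\to(0,0)$ as $n\to-\infty$ and $X_n\to(\pi,0)$ as $n\to+\infty$. Moreover, for every $x\in(0,\pi)$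 there is exactly one $y$ with $(x,y)\in\gamma^L$; a point $(x,y')$ with $x\in(0,\pi)$ is said to be above (below) $\gamma^L$ if $y'>y$ ($y'<y$) for this $y$. 2. $\operatorname{int}(s_1)$ is negatively invariant: $F^{-1}(\operatorname{int}(s_1))\subseteq\operatorname{int}(s_1)$. 3. The orbit of every $p\in s_1$ above $\gamma^L$ leaves $s_1$ and enters $s_2$: there is $N\ge 0$ such that $F^n(p)\in s_1\setminus s_2$ for $0\le n<N$, $F^n(p)\in s_2$ for all $n\ge N$, and $F^n(p)\notin s_1$ for all $n>N$. 4. The orbit of every $p\in s_1$ below $\gamma^L$ leaves $s_1$ and enters $s_3$, in the same sense with $s_3$ in place of $s_2$. -/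

import Mathlib

open Set Filter Topology

namespace ThreeClocks

noncomputable section

/-- The phase-difference map of three aligned clocks with coupling parameter `a`. -/
def F (a : ℝ) (p : ℝ × ℝ) : ℝ × ℝ :=
  (p.1 + 2 * a * Real.sin p.1 + a * Real.sin p.2,
   p.2 + a * Real.sin p.1 + 2 * a * Real.sin p.2)

/-- The square with vertices `(0,0)`, `(π/2,π/2)`, `(π,0)`, `(π/2,-π/2)`. -/
def s₁ : Set (ℝ × ℝ) :=
  {p | (p.1 - Real.pi ≤ p.2 ∧ p.2 ≤ p.1) ∧ (-p.1 ≤ p.2 ∧ p.2 ≤ -p.1 + Real.pi)}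

/-- The square with vertices `(π,0)`, `(π/2,π/2)`, `(π,π)`, `(3π/2,π/2)`. -/
def s₂ : Set (ℝ × ℝ) :=
  {p | (p.1 - Real.pi ≤ p.2 ∧ p.2 ≤ p.1) ∧
    (-p.1 + Real.pi ≤ p.2 ∧ p.2 ≤ -p.1 + 2 * Real.pi)}

/-- The square with vertices `(π,0)`, `(π/2,-π/2)`, `(π,-π)`, `(3π/2,-π/2)`. -/
def s₃ : Set (ℝ × ℝ) :=
  {p | (p.1 - 2 * Real.pi ≤ p.2 ∧ p.2 ≤ p.1 - Real.pi) ∧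
    (-p.1 ≤ p.2 ∧ p.2 ≤ -p.1 + Real.pi)}

/-- The (global) stable set of a point `Q` under `G`. -/
def stableSet (G : ℝ × ℝ → ℝ × ℝ) (Q : ℝ × ℝ) : Set (ℝ × ℝ) :=
  {p | Tendsto (fun n : ℕ => G^[n] p) atTop (𝓝 Q)}

/-- `γ` is a heteroclinic curve of `G` from `P` to `Q`: an injectively parametrized continuous
curve running from `P` to `Q` (endpoints excluded), strongly invariant under `G`, such that every
complete orbit through a point of `γ` tends to `P` in the past and to `Q` in the future. -/
structure IsHeteroclinicCurve (G : ℝ × ℝ → ℝ × ℝ) (P Q : ℝ × ℝ) (γ : Set (ℝ × ℝ)) : Prop where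
  curve : ∃ c : ℝ → ℝ × ℝ, Continuous c ∧ Function.Injective c ∧ range c = γ ∧
    Tendsto c atBot (𝓝 P) ∧ Tendsto c atTop (𝓝 Q)
  invariant : G '' γ = γ
  orbits : ∀ X : ℤ → ℝ × ℝ, (∀ n, X (n + 1) = G (X n)) → X 0 ∈ γ →
    Tendsto X atBot (𝓝 P) ∧ Tendsto X atTop (𝓝 Q)

/-- The left heteroclinic: the part of the stable manifold of the saddle `(π, 0)` that lies in
the interior of `s₁`. -/
def γL (a : ℝ) : Set (ℝ × ℝ) :=
  stableSet (F a) (Real.pi, 0) ∩ interior s₁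

/-- `p` lies vertically above a point of `γ`. -/
def IsAbove (p : ℝ × ℝ) (γ : Set (ℝ × ℝ)) : Prop :=
  ∃ y, (p.1, y) ∈ γ ∧ y < p.2

/-- `p` lies vertically below a point of `γ`. -/
def IsBelow (p : ℝ × ℝ) (γ : Set (ℝ × ℝ)) : Prop :=
  ∃ y, (p.1, y) ∈ γ ∧ p.2 < y

/-- The forward orbit of `p` under `G` leaves `A` and enters `B`: it stays in `A \ B` before some
time `N`, is in `B` from time `N` on, and is outside `A` after time `N`. (For adjacent closed
regions the orbit may touch the common edge, at time `N` only.) -/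
def LeavesInto (G : ℝ × ℝ → ℝ × ℝ) (p : ℝ × ℝ) (A B : Set (ℝ × ℝ)) : Prop :=
  ∃ N : ℕ, (∀ n < N, G^[n] p ∈ A \ B) ∧ (∀ n ≥ N, G^[n] p ∈ B) ∧ (∀ n > N, G^[n] p ∉ A)

end

end ThreeClocks

/-!
In the coordinates `u = (x + y) / 2`, `v = (x - y) / 2` the map becomes
`(u, v) ↦ (u + b sin u cos v, v + c sin v cos u)` with `b = 3a` and `c = a`, a family invariant
under swapping `u` with `v` and `b` with `c`; all estimates hold for `0 < b, c ≤ 1`, that is, for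
`0 < a ≤ 1 / 3`. On the square `s₁ = [0, π / 2]²` both coordinates increase, so an orbit other than
the fixed point `(0, 0)` which never leaves the square converges to the corner `(π / 2, π / 2)`, the
only other fixed point. An orbit that does leave the square does so through exactly one of the right
side (into `s₂`) and the upper side (into `s₃`).

The two sets of points leaving through a given side are disjoint and relatively open, and each
meets every antidiagonal `u + v = x` with `0 < x < π`. Antidiagonals being connected, each contains
a point of neither set, that is, a point of `γL`. If `q` is in the square and `p` is to its lower
right, the coordinate gaps between their orbits do not shrink while both stay in the square. Hence
two points of `γL` are never in this position, so that `γL` is the graph of a `1`-Lipschitz function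
of `x = u + v`, and a point to the lower right of `γL`, that is, above it in the plane of `x` and
`y`, leaves through the right side. Every point of `γL` is in the image of `γL` by the intermediate
value theorem, since `F` fixes both ends of the curve.
-/

namespace ThreeClocks

open Real

noncomputable section

/-! ### Monotone sequences, orbits and curves in the plane -/

section Plane

variable {f g : ℝ × ℝ → ℝ × ℝ}

theorem exists_tendsto_of_monotone {ι X Y : Type*} [Preorder ι]
    [ConditionallyCompletePartialOrderSup X] [TopologicalSpace X] [SupConvergenceClass X]
    [ConditionallyCompletePartialOrderSup Y] [TopologicalSpace Y] [SupConvergenceClass Y]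
    {u : ι → X × Y} (hu : Monotone u) (hbdd : BddAbove (range u)) :
    ∃ L, Tendsto u atTop (𝓝 L) := by
  obtain ⟨M, hM⟩ := hbdd
  have h₁ := tendsto_atTop_ciSup (monotone_fst.comp hu)
    ⟨M.1, by rintro _ ⟨i, rfl⟩; exact (hM ⟨i, rfl⟩).1⟩
  have h₂ := tendsto_atTop_ciSup (monotone_snd.comp hu)
    ⟨M.2, by rintro _ ⟨i, rfl⟩; exact (hM ⟨i, rfl⟩).2⟩
  exact ⟨_, h₁.prodMk_nhds h₂⟩

theorem exists_tendsto_of_antitone {ι X Y : Type*} [Preorder ι]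
    [ConditionallyCompletePartialOrderInf X] [TopologicalSpace X] [InfConvergenceClass X]
    [ConditionallyCompletePartialOrderInf Y] [TopologicalSpace Y] [InfConvergenceClass Y]
    {u : ι → X × Y} (hu : Antitone u) (hbdd : BddBelow (range u)) :
    ∃ L, Tendsto u atTop (𝓝 L) := by
  obtain ⟨m, hm⟩ := hbdd
  have h₁ := tendsto_atTop_ciInf (monotone_fst.comp_antitone hu)
    ⟨m.1, by rintro _ ⟨i, rfl⟩; exact (hm ⟨i, rfl⟩).1⟩
  have h₂ := tendsto_atTop_ciInf (monotone_snd.comp_antitone hu)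
    ⟨m.2, by rintro _ ⟨i, rfl⟩; exact (hm ⟨i, rfl⟩).2⟩
  exact ⟨_, h₁.prodMk_nhds h₂⟩

theorem isFixedPt_of_tendsto_backward_orbit {α : Type*} [TopologicalSpace α] [T2Space α]
    {G : α → α} (hG : Continuous G) {X : ℕ → α} (hX : ∀ n, G (X (n + 1)) = X n) {L : α}
    (hL : Tendsto X atTop (𝓝 L)) : Function.IsFixedPt G L := by
  have hGL := (hG.tendsto L).comp ((tendsto_add_atTop_iff_nat 1).2 hL)
  exact tendsto_nhds_unique (hGL.congr hX) hL

theorem tendsto_int_atTop_iff_nat {α : Type*} {X : ℤ → α} {l : Filter α} :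
    Tendsto X atTop l ↔ Tendsto (fun n : ℕ => X n) atTop l := by
  rw [← Nat.map_cast_int_atTop, tendsto_map'_iff, Function.comp_def]

theorem tendsto_int_atBot_iff_nat {α : Type*} {X : ℤ → α} {l : Filter α} :
    Tendsto X atBot l ↔ Tendsto (fun n : ℕ => X (-n)) atTop l := by
  rw [← tendsto_int_atTop_iff_nat (X := fun n => X (-n)), ← map_neg_atTop, tendsto_map'_iff,
    Function.comp_def]

theorem orbit_natCast_eq_iterate {α : Type*} {G : α → α} {X : ℤ → α}
    (hX : ∀ n, X (n + 1) = G (X n)) (n : ℕ) : X n = G^[n] (X 0) := by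
  induction n with
  | zero => rfl
  | succ n ih => rw [Function.iterate_succ_apply', ← ih, ← hX, Nat.cast_succ]

theorem stableSet_eq_preimage (T : ℝ × ℝ ≃ₜ ℝ × ℝ) (h : Function.Semiconj T f g) (P : ℝ × ℝ) :
    stableSet f P = T ⁻¹' stableSet g (T P) := by
  ext p
  simp only [stableSet, mem_ofPred_eq, mem_preimage, ← (h.iterate_right _).eq]
  exact T.isInducing.tendsto_nhds_iff

theorem LeavesInto.of_semiconj {T : ℝ × ℝ → ℝ × ℝ} (h : Function.Semiconj T f g) {p : ℝ × ℝ}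
    {A B : Set (ℝ × ℝ)} (hp : LeavesInto g (T p) A B) : LeavesInto f p (T ⁻¹' A) (T ⁻¹' B) := by
  simpa only [LeavesInto, Set.mem_sdiff, mem_preimage, (h.iterate_right _).eq] using hp

theorem exists_curve_range_eq_graph {E : Type*} [TopologicalSpace E] {h : ℝ → E} {l r : ℝ}
    {A B : E} (hlr : l < r) (hh : ContinuousOn h (Ioo l r)) (hl : Tendsto h (𝓝[>] l) (𝓝 A))
    (hr : Tendsto h (𝓝[<] r) (𝓝 B)) :
    ∃ c : ℝ → ℝ × E, Continuous c ∧ Function.Injective c ∧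
      range c = (fun x => (x, h x)) '' Ioo l r ∧
      Tendsto c atBot (𝓝 (l, A)) ∧ Tendsto c atTop (𝓝 (r, B)) := by
  let φ : ℝ → ℝ := fun t => l + (r - l) * sigmoid t
  have hlr' : 0 < r - l := sub_pos.2 hlr
  have hφ : Continuous φ := by fun_prop
  have hφ_inj : Function.Injective φ := fun s t hst =>
    sigmoid_injective (mul_left_cancel₀ hlr'.ne' (add_left_cancel hst))
  have hφ_range : range φ = Ioo l r := by
    rw [show φ = (fun y => l + y) ∘ (fun y => (r - l) * y) ∘ sigmoid from rfl, range_comp,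
      range_comp, range_sigmoid, image_mul_left_Ioo hlr', image_const_add_Ioo]
    simp only [mul_zero, mul_one, add_zero, add_sub_cancel]
  have hφ_mem : ∀ t, φ t ∈ Ioo l r := fun t => hφ_range ▸ mem_range_self t
  have hφ_bot : Tendsto φ atBot (𝓝 l) := by
    simpa using (tendsto_sigmoid_atBot.const_mul (r - l)).const_add l
  have hφ_top : Tendsto φ atTop (𝓝 r) := by
    simpa using (tendsto_sigmoid_atTop.const_mul (r - l)).const_add l
  refine ⟨fun t => (φ t, h (φ t)), hφ.prodMk (hh.comp_continuous hφ hφ_mem),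
    fun s t hst => hφ_inj (congrArg Prod.fst hst), ?_,
    hφ_bot.prodMk_nhds (hl.comp (tendsto_nhdsWithin_iff.2 ⟨hφ_bot, ?_⟩)),
    hφ_top.prodMk_nhds (hr.comp (tendsto_nhdsWithin_iff.2 ⟨hφ_top, ?_⟩))⟩
  · rw [← hφ_range, ← range_comp]
    rfl
  · exact Eventually.of_forall fun t => (hφ_mem t).1
  · exact Eventually.of_forall fun t => (hφ_mem t).2

/-- By the intermediate value theorem, the first coordinates of `G ∘ c` cover those of `γ`. -/
theorem image_eq_of_mapsTo_of_curve {E : Type*} [TopologicalSpace E] {G : ℝ × E → ℝ × E}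
    {γ : Set (ℝ × E)} {P Q : ℝ × E} {c : ℝ → ℝ × E} (hG : Continuous G) (hP : G P = P)
    (hQ : G Q = Q) (hc : Continuous c) (hrange : range c = γ) (hbot : Tendsto c atBot (𝓝 P))
    (htop : Tendsto c atTop (𝓝 Q)) (hinj : InjOn Prod.fst γ)
    (hfst : MapsTo Prod.fst γ (Ioo P.1 Q.1)) (hmaps : MapsTo G γ γ) : G '' γ = γ := by
  refine hmaps.image_subset.antisymm fun w hw => ?_
  have hbot' : Tendsto (fun t => (G (c t)).1) atBot (𝓝 P.1) := by
    simpa only [hP, Function.comp_def] using ((hG.tendsto P).comp hbot).fst_nhds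
  have htop' : Tendsto (fun t => (G (c t)).1) atTop (𝓝 Q.1) := by
    simpa only [hQ, Function.comp_def] using ((hG.tendsto Q).comp htop).fst_nhds
  obtain ⟨t, ht⟩ := mem_range_of_exists_le_of_exists_ge (continuous_fst.comp (hG.comp hc))
    (hbot'.eventually_le_const (hfst hw).1).exists (htop'.eventually_const_le (hfst hw).2).exists
  have hct : c t ∈ γ := hrange ▸ mem_range_self t
  exact ⟨c t, hct, hinj (hmaps hct) hw ht⟩

end Plane

/-! ### The map in diagonal coordinates -/

/-- The map `F` in the coordinates `(u, v) = ((x + y) / 2, (x - y) / 2)`, where it takes the form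
`(u + b sin u cos v, v + c sin v cos u)` with `b = 3a` and `c = a`. The couplings `b` and `c` are
kept independent so that swapping the coordinates is a symmetry of the family. -/
def diagMap (b c : ℝ) (p : ℝ × ℝ) : ℝ × ℝ :=
  (p.1 + b * (sin p.1 * cos p.2), p.2 + c * (sin p.2 * cos p.1))

/-- The square `s₁` in the diagonal coordinates. -/
def baseSquare : Set (ℝ × ℝ) := Icc 0 (π / 2) ×ˢ Icc 0 (π / 2)

/-- The square `s₂` in the diagonal coordinates; `s₃` is its image under `Prod.swap`. -/
def rightSquare : Set (ℝ × ℝ) := Icc (π / 2) π ×ˢ Icc 0 (π / 2)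

/-- The square `rightSquare` without its two sides through the corner `(π / 2, π / 2)`: unlike
`rightSquare` it is disjoint from `baseSquare`. -/
def rightRegion : Set (ℝ × ℝ) := Ioc (π / 2) π ×ˢ Ico 0 (π / 2)

/-- The points whose orbit crosses the right side `u = π / 2` of `baseSquare`. -/
def exitsRight (b c : ℝ) : Set (ℝ × ℝ) := {p | ∃ n : ℕ, π / 2 < ((diagMap b c)^[n] p).1}

/-- The points whose orbit crosses the upper side `v = π / 2` of `baseSquare`. -/
def exitsUp (b c : ℝ) : Set (ℝ × ℝ) := {p | ∃ n : ℕ, π / 2 < ((diagMap b c)^[n] p).2}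

/-- The stable set of the saddle `(π / 2, π / 2)` in the open square: the curve `γL` in the
diagonal coordinates. -/
def diagCurve (b c : ℝ) : Set (ℝ × ℝ) :=
  stableSet (diagMap b c) (π / 2, π / 2) ∩ interior baseSquare

variable {b c : ℝ} {p q : ℝ × ℝ}

theorem continuous_diagMap (b c : ℝ) : Continuous (diagMap b c) := by
  unfold diagMap
  fun_prop

theorem diagMap_semiconj_swap (b c : ℝ) :
    Function.Semiconj Prod.swap (diagMap b c) (diagMap c b) := fun _ => rfl

theorem iterate_diagMap_swap (b c : ℝ) (n : ℕ) (p : ℝ × ℝ) :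
    (diagMap c b)^[n] p.swap = ((diagMap b c)^[n] p).swap :=
  (((diagMap_semiconj_swap b c).iterate_right n).eq p).symm

theorem isClosed_baseSquare : IsClosed baseSquare := isClosed_Icc.prod isClosed_Icc

theorem convex_baseSquare : Convex ℝ baseSquare := (convex_Icc _ _).prod (convex_Icc _ _)

theorem interior_baseSquare : interior baseSquare = Ioo 0 (π / 2) ×ˢ Ioo 0 (π / 2) := by
  rw [baseSquare, interior_prod_eq, interior_Icc]

theorem swap_mem_baseSquare : p.swap ∈ baseSquare ↔ p ∈ baseSquare := and_comm

theorem swap_mem_exitsRight : p.swap ∈ exitsRight c b ↔ p ∈ exitsUp b c := by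
  simp only [exitsRight, exitsUp, mem_ofPred_eq, iterate_diagMap_swap, Prod.fst_swap]

theorem swap_mem_exitsUp : p.swap ∈ exitsUp c b ↔ p ∈ exitsRight b c := by
  rw [← swap_mem_exitsRight, Prod.swap_swap]

theorem swap_mem_diagCurve : p.swap ∈ diagCurve c b ↔ p ∈ diagCurve b c := by
  have hstable := stableSet_eq_preimage (Homeomorph.prodComm ℝ ℝ) (diagMap_semiconj_swap b c)
    (π / 2, π / 2)
  rw [diagCurve, diagCurve, hstable, interior_baseSquare]
  exact and_congr_right' and_comm

/-! ### One step of the map -/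

theorem abs_diagMap_fst_sub_le (hb : |b| ≤ 1) :
    |(diagMap b c p).1 - p.1| ≤ |sin p.1| * |cos p.2| := by
  rw [diagMap, add_sub_cancel_left, abs_mul, abs_mul]
  exact mul_le_of_le_one_left (by positivity) hb

theorem abs_diagMap_fst_sub_le_abs_fst (hb : |b| ≤ 1) :
    |(diagMap b c p).1 - p.1| ≤ |p.1| :=
  calc |(diagMap b c p).1 - p.1| ≤ |sin p.1| * |cos p.2| := abs_diagMap_fst_sub_le hb
    _ ≤ |sin p.1| := mul_le_of_le_one_right (abs_nonneg _) (abs_cos_le_one _)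
    _ ≤ |p.1| := abs_sin_le_abs

theorem abs_diagMap_fst_sub_le_abs_pi_sub_fst (hb : |b| ≤ 1) :
    |(diagMap b c p).1 - p.1| ≤ |π - p.1| :=
  calc |(diagMap b c p).1 - p.1| ≤ |sin p.1| * |cos p.2| := abs_diagMap_fst_sub_le hb
    _ ≤ |sin p.1| := mul_le_of_le_one_right (abs_nonneg _) (abs_cos_le_one _)
    _ = |sin (π - p.1)| := by rw [sin_pi_sub]
    _ ≤ |π - p.1| := abs_sin_le_abs

theorem abs_diagMap_fst_sub_le_abs_cos_snd (hb : |b| ≤ 1) :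
    |(diagMap b c p).1 - p.1| ≤ |cos p.2| :=
  (abs_diagMap_fst_sub_le hb).trans (mul_le_of_le_one_left (abs_nonneg _) (abs_sin_le_one _))

theorem abs_diagMap_fst_sub_le_abs_pi_div_two_sub_snd (hb : |b| ≤ 1) :
    |(diagMap b c p).1 - p.1| ≤ |π / 2 - p.2| :=
  calc |(diagMap b c p).1 - p.1| ≤ |cos p.2| := abs_diagMap_fst_sub_le_abs_cos_snd hb
    _ = |sin (π / 2 - p.2)| := by rw [sin_pi_div_two_sub]
    _ ≤ |π / 2 - p.2| := abs_sin_le_abs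

theorem abs_diagMap_fst_sub_lt_abs_pi_div_two_sub_snd (hb : |b| ≤ 1) (h : p.2 ≠ π / 2) :
    |(diagMap b c p).1 - p.1| < |π / 2 - p.2| :=
  calc |(diagMap b c p).1 - p.1| ≤ |cos p.2| := abs_diagMap_fst_sub_le_abs_cos_snd hb
    _ = |sin (π / 2 - p.2)| := by rw [sin_pi_div_two_sub]
    _ < |π / 2 - p.2| := abs_sin_lt_abs (sub_ne_zero.2 h.symm)

theorem le_diagMap_fst (hb : 0 ≤ b) (h₁ : p.1 ∈ Icc 0 π) (h₂ : p.2 ∈ Icc (-(π / 2)) (π / 2)) :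
    p.1 ≤ (diagMap b c p).1 :=
  le_add_of_nonneg_right <| mul_nonneg hb <|
    mul_nonneg (sin_nonneg_of_mem_Icc h₁) (cos_nonneg_of_mem_Icc h₂)

theorem lt_diagMap_fst (hb : 0 < b) (h₁ : p.1 ∈ Ioo 0 π) (h₂ : p.2 ∈ Ioo (-(π / 2)) (π / 2)) :
    p.1 < (diagMap b c p).1 :=
  lt_add_of_pos_right _ <| mul_pos hb <| mul_pos (sin_pos_of_mem_Ioo h₁) (cos_pos_of_mem_Ioo h₂)

theorem diagMap_snd_le (hc : 0 ≤ c) (h₁ : p.1 ∈ Icc (π / 2) (π + π / 2)) (h₂ : p.2 ∈ Icc 0 π) :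
    (diagMap b c p).2 ≤ p.2 :=
  add_le_of_nonpos_right <| mul_nonpos_of_nonneg_of_nonpos hc <|
    mul_nonpos_of_nonneg_of_nonpos (sin_nonneg_of_mem_Icc h₂)
      (cos_nonpos_of_pi_div_two_le_of_le h₁.1 h₁.2)

theorem le_diagMap (hb : 0 ≤ b) (hc : 0 ≤ c) (hp : p ∈ baseSquare) : p ≤ diagMap b c p := by
  obtain ⟨⟨hu₀, hu₁⟩, hv₀, hv₁⟩ := hp
  have hpi := pi_pos
  exact ⟨le_diagMap_fst hb ⟨hu₀, by linarith⟩ ⟨by linarith, hv₁⟩,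
    le_diagMap_fst (c := b) (p := p.swap) hc ⟨hv₀, by simp only [Prod.fst_swap]; linarith⟩
      ⟨by simp only [Prod.snd_swap]; linarith, hu₁⟩⟩

theorem fst_eq_or_snd_eq_of_isFixedPt (hb : 0 < b) (hp : p ∈ baseSquare)
    (h : Function.IsFixedPt (diagMap b c) p) : p.1 = 0 ∨ p.2 = π / 2 := by
  obtain ⟨⟨hu₀, hu₁⟩, hv₀, hv₁⟩ := hp
  have hpi := pi_pos
  by_contra! hne
  have hlt := lt_diagMap_fst (c := c) hb ⟨hu₀.lt_of_ne' hne.1, by linarith⟩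
    ⟨by linarith, hv₁.lt_of_ne hne.2⟩
  rw [h.eq] at hlt
  exact hlt.false

theorem eq_of_isFixedPt (hb : 0 < b) (hc : 0 < c) (hp : p ∈ baseSquare)
    (h : Function.IsFixedPt (diagMap b c) p) : p = (0, 0) ∨ p = (π / 2, π / 2) := by
  have hpi := pi_pos
  have hswap : Function.IsFixedPt (diagMap c b) p.swap := congrArg Prod.swap h
  rcases fst_eq_or_snd_eq_of_isFixedPt hb hp h with hu | hv <;>
  rcases fst_eq_or_snd_eq_of_isFixedPt hc (swap_mem_baseSquare.2 hp) hswap with hv' | hu' <;>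
  simp only [Prod.fst_swap, Prod.snd_swap] at *
  · exact Or.inl (Prod.ext hu hv')
  · linarith
  · linarith
  · exact Or.inr (Prod.ext hu' hv)

theorem abs_le_one_of_mem_Ioc (hb : b ∈ Ioc 0 1) : |b| ≤ 1 :=
  abs_le.2 ⟨by linarith [hb.1], hb.2⟩

theorem diagMap_mem_rightRegion (hb : b ∈ Ioc 0 1) (hc : c ∈ Ioc 0 1) (hp : p ∈ rightSquare)
    (hlt : p.2 < π / 2) : diagMap b c p ∈ rightRegion := by
  obtain ⟨⟨hu₀, hu₁⟩, hv₀, -⟩ := hp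
  have hright := abs_diagMap_fst_sub_le_abs_pi_sub_fst (c := c) (p := p) (abs_le_one_of_mem_Ioc hb)
  have hbottom : |(diagMap b c p).2 - p.2| ≤ |p.2| :=
    abs_diagMap_fst_sub_le_abs_fst (c := b) (p := p.swap) (abs_le_one_of_mem_Ioc hc)
  rw [abs_of_nonneg (sub_nonneg.2 hu₁), abs_le] at hright
  rw [abs_of_nonneg hv₀, abs_le] at hbottom
  have hv' : (diagMap b c p).2 ≤ p.2 :=
    diagMap_snd_le hc.1.le ⟨hu₀, by linarith⟩ ⟨hv₀, by linarith⟩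
  have hu' : π / 2 < (diagMap b c p).1 := by
    rcases hu₁.lt_or_eq with hu | hu
    · exact hu₀.trans_lt (lt_diagMap_fst hb.1 ⟨by linarith, hu⟩ ⟨by linarith, hlt⟩)
    · linarith
  exact ⟨⟨hu', by linarith⟩, by linarith, by linarith⟩

theorem diagMap_mem_rightRegion_of_lt (hb : b ∈ Ioc 0 1) (hc : c ∈ Ioc 0 1)
    (hp : p ∈ baseSquare) (hlt : π / 2 < (diagMap b c p).1) : diagMap b c p ∈ rightRegion := by
  have hle := le_diagMap hb.1.le hc.1.le hp
  obtain ⟨⟨-, hu₁⟩, hv₀, hv₁⟩ := hp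
  have hu := abs_diagMap_fst_sub_le_abs_pi_div_two_sub_snd (c := c) (p := p)
    (abs_le_one_of_mem_Ioc hb)
  have hv : |(diagMap b c p).2 - p.2| ≤ |π / 2 - p.1| :=
    abs_diagMap_fst_sub_le_abs_pi_div_two_sub_snd (c := b) (p := p.swap) (abs_le_one_of_mem_Ioc hc)
  rw [abs_of_nonneg (sub_nonneg.2 hv₁), abs_le] at hu
  rw [abs_of_nonneg (sub_nonneg.2 hu₁), abs_le] at hv
  exact ⟨⟨hlt, by linarith⟩, hv₀.trans hle.2, by linarith⟩

theorem diagMap_ne_corner (hb : |b| ≤ 1) (hc : |c| ≤ 1) (hp : p ∈ interior baseSquare) :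
    diagMap b c p ≠ (π / 2, π / 2) := by
  rw [interior_baseSquare] at hp
  obtain ⟨⟨-, hu₁⟩, -, hv₁⟩ := hp
  intro h
  have hu := abs_diagMap_fst_sub_lt_abs_pi_div_two_sub_snd (c := c) hb hv₁.ne
  have hv : |(diagMap b c p).2 - p.2| < |π / 2 - p.1| :=
    abs_diagMap_fst_sub_lt_abs_pi_div_two_sub_snd (c := b) (p := p.swap) hc hu₁.ne
  rw [h] at hu hv
  exact hu.asymm hv

theorem fst_mem_Ioo_of_diagMap (hb : |b| ≤ 1) (h : (diagMap b c p).1 ∈ Ioo 0 π) :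
    p.1 ∈ Ioo 0 π := by
  have hl := abs_diagMap_fst_sub_le_abs_fst (c := c) (p := p) hb
  have hr := abs_diagMap_fst_sub_le_abs_pi_sub_fst (c := c) (p := p) hb
  obtain ⟨h₀, h₁⟩ := h
  constructor <;> by_contra! hout
  · rw [abs_of_nonpos hout, abs_le] at hl
    linarith
  · rw [abs_of_nonpos (sub_nonpos.2 hout), abs_le] at hr
    linarith

theorem preimage_interior_baseSquare_subset (hb : b ∈ Ioc 0 1) (hc : c ∈ Ioc 0 1) :
    diagMap b c ⁻¹' interior baseSquare ⊆ interior baseSquare := by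
  intro p hp
  rw [interior_baseSquare] at hp ⊢
  obtain ⟨⟨hu₀, hu₁⟩, hv₀, hv₁⟩ := hp
  have hb' := abs_le_one_of_mem_Ioc hb
  have hc' := abs_le_one_of_mem_Ioc hc
  have hu : p.1 ∈ Ioo 0 π := fst_mem_Ioo_of_diagMap hb' ⟨hu₀, by linarith⟩
  have hv : p.2 ∈ Ioo 0 π :=
    fst_mem_Ioo_of_diagMap (c := b) (p := p.swap) hc' ⟨hv₀, hv₁.trans (by linarith)⟩
  have hu_lt : p.2 ≤ π / 2 → p.1 < π / 2 := fun hle =>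
    (le_diagMap_fst hb.1.le ⟨hu.1.le, hu.2.le⟩ ⟨by linarith [hv.1], hle⟩).trans_lt hu₁
  have hv_lt : p.1 ≤ π / 2 → p.2 < π / 2 := fun hle =>
    (le_diagMap_fst (c := b) (p := p.swap) hc.1.le ⟨hv.1.le, hv.2.le⟩
      ⟨le_trans (by linarith) hu.1.le, hle⟩).trans_lt hv₁
  suffices h : p.1 ≤ π / 2 ∨ p.2 ≤ π / 2 by
    rcases h with h | h
    · exact ⟨⟨hu.1, hu_lt (hv_lt h).le⟩, hv.1, hv_lt h⟩
    · exact ⟨⟨hu.1, hu_lt h⟩, hv.1, hv_lt (hu_lt h).le⟩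
  by_contra! hgt
  have hu_abs := abs_diagMap_fst_sub_le_abs_pi_div_two_sub_snd (c := c) (p := p) hb'
  have hv_abs : |(diagMap b c p).2 - p.2| ≤ |π / 2 - p.1| :=
    abs_diagMap_fst_sub_le_abs_pi_div_two_sub_snd (c := b) (p := p.swap) hc'
  rw [abs_of_nonpos (sub_nonpos.2 hgt.2.le), abs_le] at hu_abs
  rw [abs_of_nonpos (sub_nonpos.2 hgt.1.le), abs_le] at hv_abs
  linarith

/-! ### Orbits starting in the square -/

theorem mapsTo_rightRegion (hb : b ∈ Ioc 0 1) (hc : c ∈ Ioc 0 1) :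
    MapsTo (diagMap b c) rightRegion rightRegion := fun _ hp =>
  diagMap_mem_rightRegion hb hc (prod_mono Ioc_subset_Icc_self Ico_subset_Icc_self hp) hp.2.2

theorem mapsTo_union_rightRegion (hb : b ∈ Ioc 0 1) (hc : c ∈ Ioc 0 1) :
    MapsTo (diagMap b c) (baseSquare ∪ (rightRegion ∪ Prod.swap ⁻¹' rightRegion))
      (baseSquare ∪ (rightRegion ∪ Prod.swap ⁻¹' rightRegion)) := by
  rintro p (hp | hp | hp)
  · have hle := le_diagMap hb.1.le hc.1.le hp
    by_cases hu : π / 2 < (diagMap b c p).1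
    · exact Or.inr (Or.inl (diagMap_mem_rightRegion_of_lt hb hc hp hu))
    by_cases hv : π / 2 < (diagMap b c p).2
    · exact Or.inr (Or.inr (diagMap_mem_rightRegion_of_lt hc hb (swap_mem_baseSquare.2 hp) hv))
    · exact Or.inl ⟨⟨hp.1.1.trans hle.1, not_lt.1 hu⟩, hp.2.1.trans hle.2, not_lt.1 hv⟩
  · exact Or.inr (Or.inl (mapsTo_rightRegion hb hc hp))
  · exact Or.inr (Or.inr (mapsTo_rightRegion hc hb hp))

theorem iterate_mem_baseSquare_of_le (hb : b ∈ Ioc 0 1) (hc : c ∈ Ioc 0 1) (hp : p ∈ baseSquare)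
    {n : ℕ} (hu : ((diagMap b c)^[n] p).1 ≤ π / 2) (hv : ((diagMap b c)^[n] p).2 ≤ π / 2) :
    (diagMap b c)^[n] p ∈ baseSquare := by
  rcases (mapsTo_union_rightRegion hb hc).iterate n (Or.inl hp) with h | h | h
  · exact h
  · exact absurd h.1.1 hu.not_gt
  · exact absurd h.1.1 hv.not_gt

theorem iterate_mem_rightRegion (hb : b ∈ Ioc 0 1) (hc : c ∈ Ioc 0 1) (hp : p ∈ baseSquare)
    {m n : ℕ} (hmn : n ≤ m) (hn : π / 2 < ((diagMap b c)^[n] p).1) :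
    (diagMap b c)^[m] p ∈ rightRegion := by
  have hmem : (diagMap b c)^[n] p ∈ rightRegion := by
    rcases (mapsTo_union_rightRegion hb hc).iterate n (Or.inl hp) with h | h | h
    · exact absurd hn h.1.2.not_gt
    · exact h
    · exact absurd hn (not_lt_of_gt h.2.2)
  obtain ⟨k, rfl⟩ := Nat.exists_eq_add_of_le' hmn
  rw [Function.iterate_add_apply]
  exact (mapsTo_rightRegion hb hc).iterate k hmem

theorem notMem_exitsUp_of_mem_exitsRight (hb : b ∈ Ioc 0 1) (hc : c ∈ Ioc 0 1)
    (hp : p ∈ baseSquare) (h : p ∈ exitsRight b c) : p ∉ exitsUp b c := by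
  rintro ⟨m, hm⟩
  obtain ⟨n, hn⟩ := h
  have hright := iterate_mem_rightRegion hb hc hp (le_max_left n m) hn
  have hup : (diagMap c b)^[max n m] p.swap ∈ rightRegion :=
    iterate_mem_rightRegion hc hb (swap_mem_baseSquare.2 hp) (le_max_right n m)
      (by rwa [iterate_diagMap_swap])
  rw [iterate_diagMap_swap] at hup
  exact hright.1.1.not_gt hup.2.2

theorem iterate_mem_baseSquare (hb : b ∈ Ioc 0 1) (hc : c ∈ Ioc 0 1) (hp : p ∈ baseSquare)
    (hright : p ∉ exitsRight b c) (hup : p ∉ exitsUp b c) (n : ℕ) :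
    (diagMap b c)^[n] p ∈ baseSquare :=
  iterate_mem_baseSquare_of_le hb hc hp (not_lt.1 fun h => hright ⟨n, h⟩)
    (not_lt.1 fun h => hup ⟨n, h⟩)

theorem isOpen_exitsRight (b c : ℝ) : IsOpen (exitsRight b c) := by
  simp only [exitsRight, ofPred_exists]
  exact isOpen_iUnion fun n =>
    isOpen_lt continuous_const (continuous_fst.comp ((continuous_diagMap b c).iterate n))

theorem isOpen_exitsUp (b c : ℝ) : IsOpen (exitsUp b c) := by
  simp only [exitsUp, ofPred_exists]
  exact isOpen_iUnion fun n =>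
    isOpen_lt continuous_const (continuous_snd.comp ((continuous_diagMap b c).iterate n))

theorem tendsto_iterate_corner (hb : b ∈ Ioc 0 1) (hc : c ∈ Ioc 0 1)
    (hmem : ∀ n, (diagMap b c)^[n] p ∈ baseSquare) (hp : p ≠ (0, 0)) :
    Tendsto (fun n => (diagMap b c)^[n] p) atTop (𝓝 (π / 2, π / 2)) := by
  have hmono : Monotone fun n => (diagMap b c)^[n] p := monotone_nat_of_le_succ fun n => by
    rw [Function.iterate_succ_apply']
    exact le_diagMap hb.1.le hc.1.le (hmem n)
  obtain ⟨L, hL⟩ := exists_tendsto_of_monotone hmono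
    ⟨(π / 2, π / 2), by rintro _ ⟨n, rfl⟩; exact ⟨(hmem n).1.2, (hmem n).2.2⟩⟩
  have hfixed := isFixedPt_of_tendsto_iterate hL (continuous_diagMap b c).continuousAt
  have hLmem := isClosed_baseSquare.mem_of_tendsto hL (Eventually.of_forall hmem)
  rcases eq_of_isFixedPt hb.1 hc.1 hLmem hfixed with rfl | rfl
  · have hle : p ≤ (0, 0) := hmono.ge_of_tendsto hL 0
    exact absurd (hle.antisymm ⟨(hmem 0).1.1, (hmem 0).2.1⟩) hp
  · exact hL

theorem mem_exitsRight_of_fst_eq (hb : b ∈ Ioc 0 1) (hc : c ∈ Ioc 0 1) (hp : p ∈ baseSquare)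
    (hu : p.1 = π / 2) (hv : p.2 < π / 2) : p ∈ exitsRight b c :=
  ⟨1, (diagMap_mem_rightRegion hb hc ⟨⟨hu.ge, by linarith [pi_pos]⟩, hp.2⟩ hv).1.1⟩

theorem mem_exitsRight_of_snd_eq_zero (hb : b ∈ Ioc 0 1) (hc : c ∈ Ioc 0 1)
    (hp : p ∈ baseSquare) (hv : p.2 = 0) (hu : p.1 ≠ 0) : p ∈ exitsRight b c := by
  have hpi := pi_pos
  have haxis : ∀ n, ((diagMap b c)^[n] p).2 = 0 := fun n => by
    induction n with
    | zero => exact hv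
    | succ n ih =>
      rw [Function.iterate_succ_apply', diagMap, ih, sin_zero, zero_mul, mul_zero, add_zero]
  by_contra hright
  have hmem := iterate_mem_baseSquare hb hc hp hright
    (by rintro ⟨n, hn⟩; linarith [haxis n])
  have hlim := (tendsto_iterate_corner hb hc hmem fun h => hu (congrArg Prod.fst h)).snd_nhds
  linarith [tendsto_nhds_unique hlim (tendsto_const_nhds.congr fun n => (haxis n).symm)]

/-! ### The stable curve of the corner -/

theorem diagCurve_subset_baseSquare : diagCurve b c ⊆ baseSquare :=
  inter_subset_right.trans interior_subset

theorem notMem_exitsRight_of_mem_diagCurve (hb : b ∈ Ioc 0 1) (hc : c ∈ Ioc 0 1)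
    (hp : p ∈ diagCurve b c) : p ∉ exitsRight b c := by
  rintro ⟨n, hn⟩
  have hmono : Monotone fun k => ((diagMap b c)^[k + n] p).1 := monotone_nat_of_le_succ fun k => by
    obtain ⟨⟨hu₀, hu₁⟩, hv₀, hv₁⟩ := iterate_mem_rightRegion hb hc
      (diagCurve_subset_baseSquare hp) (Nat.le_add_left n k) hn
    rw [Nat.succ_add, Function.iterate_succ_apply']
    exact le_diagMap_fst hb.1.le ⟨by linarith, hu₁⟩ ⟨by linarith, hv₁.le⟩
  have hlim : Tendsto (fun k => (diagMap b c)^[k + n] p) atTop (𝓝 (π / 2, π / 2)) :=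
    (tendsto_add_atTop_iff_nat n).2 hp.1
  have hle := hmono.ge_of_tendsto hlim.fst_nhds 0
  rw [Nat.zero_add] at hle
  exact hn.not_ge hle

theorem notMem_exitsUp_of_mem_diagCurve (hb : b ∈ Ioc 0 1) (hc : c ∈ Ioc 0 1)
    (hp : p ∈ diagCurve b c) : p ∉ exitsUp b c := fun h =>
  notMem_exitsRight_of_mem_diagCurve hc hb (swap_mem_diagCurve.2 hp) (swap_mem_exitsRight.2 h)

theorem iterate_mem_baseSquare_of_mem_diagCurve (hb : b ∈ Ioc 0 1) (hc : c ∈ Ioc 0 1)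
    (hp : p ∈ diagCurve b c) (n : ℕ) : (diagMap b c)^[n] p ∈ baseSquare :=
  iterate_mem_baseSquare hb hc (diagCurve_subset_baseSquare hp)
    (notMem_exitsRight_of_mem_diagCurve hb hc hp) (notMem_exitsUp_of_mem_diagCurve hb hc hp) n

theorem fst_lt_and_snd_pos_of_notMem_exitsRight (hb : b ∈ Ioc 0 1) (hc : c ∈ Ioc 0 1)
    (hp : p ∈ baseSquare) (hzero : p ≠ (0, 0)) (hcorner : p ≠ (π / 2, π / 2))
    (hright : p ∉ exitsRight b c) : p.1 < π / 2 ∧ 0 < p.2 := by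
  constructor
  · refine hp.1.2.lt_of_ne fun hu => hright (mem_exitsRight_of_fst_eq hb hc hp hu ?_)
    exact hp.2.2.lt_of_ne fun hv => hcorner (Prod.ext hu hv)
  · refine hp.2.1.lt_of_ne' fun hv => hright (mem_exitsRight_of_snd_eq_zero hb hc hp hv ?_)
    exact fun hu => hzero (Prod.ext hu hv)

theorem mem_diagCurve_of_notMem_exits (hb : b ∈ Ioc 0 1) (hc : c ∈ Ioc 0 1)
    (hp : p ∈ baseSquare) (hzero : p ≠ (0, 0)) (hcorner : p ≠ (π / 2, π / 2))
    (hright : p ∉ exitsRight b c) (hup : p ∉ exitsUp b c) : p ∈ diagCurve b c := by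
  refine ⟨tendsto_iterate_corner hb hc (iterate_mem_baseSquare hb hc hp hright hup) hzero, ?_⟩
  rw [interior_baseSquare]
  have h₁ := fst_lt_and_snd_pos_of_notMem_exitsRight hb hc hp hzero hcorner hright
  have h₂ := fst_lt_and_snd_pos_of_notMem_exitsRight hc hb (swap_mem_baseSquare.2 hp)
    (fun h => hzero (Prod.swap_injective h)) (fun h => hcorner (Prod.swap_injective h))
    (fun h => hup (swap_mem_exitsRight.1 h))
  exact ⟨⟨h₂.2, h₁.1⟩, h₁.2, h₂.1⟩

theorem exists_mem_exitsRight_add_eq (hb : b ∈ Ioc 0 1) (hc : c ∈ Ioc 0 1) {x : ℝ}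
    (hx : x ∈ Ioo 0 π) : ∃ p ∈ baseSquare, p.1 + p.2 = x ∧ p ∈ exitsRight b c := by
  obtain ⟨hx₀, hx₁⟩ := hx
  rcases le_total x (π / 2) with h | h
  · have hp : (x, (0 : ℝ)) ∈ baseSquare := ⟨⟨hx₀.le, h⟩, le_rfl, by positivity⟩
    exact ⟨_, hp, add_zero x, mem_exitsRight_of_snd_eq_zero hb hc hp rfl hx₀.ne'⟩
  · have hp : (π / 2, x - π / 2) ∈ baseSquare :=
      ⟨⟨by positivity, le_rfl⟩, by linarith, by linarith⟩
    exact ⟨_, hp, add_sub_cancel _ _, mem_exitsRight_of_fst_eq hb hc hp rfl (by linarith)⟩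

theorem exists_mem_diagCurve_add_eq (hb : b ∈ Ioc 0 1) (hc : c ∈ Ioc 0 1) {x : ℝ}
    (hx : x ∈ Ioo 0 π) : ∃ p ∈ diagCurve b c, p.1 + p.2 = x := by
  have hconn : IsPreconnected (baseSquare ∩ {p | p.1 + p.2 = x}) :=
    (convex_baseSquare.inter
      (convex_hyperplane (LinearMap.fst ℝ ℝ ℝ + LinearMap.snd ℝ ℝ ℝ).isLinear x)).isPreconnected
  obtain ⟨r, hr, hrx, hr_exits⟩ := exists_mem_exitsRight_add_eq hb hc hx
  obtain ⟨u, hu, hux, hu_exits⟩ := exists_mem_exitsRight_add_eq hc hb hx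
  obtain ⟨p, ⟨hp, hpx⟩, hright, hup⟩ : ∃ p ∈ baseSquare ∩ {p | p.1 + p.2 = x},
      p ∉ exitsRight b c ∧ p ∉ exitsUp b c := by
    by_contra! hcover
    obtain ⟨p, ⟨hp, -⟩, hright, hup⟩ := hconn _ _ (isOpen_exitsRight b c) (isOpen_exitsUp b c)
      (fun p hp => or_iff_not_imp_left.2 (hcover p hp)) ⟨r, ⟨hr, hrx⟩, hr_exits⟩
      ⟨u.swap, ⟨swap_mem_baseSquare.2 hu, (add_comm _ _).trans hux⟩,
        swap_mem_exitsUp.2 hu_exits⟩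
    exact notMem_exitsUp_of_mem_exitsRight hb hc hp hright hup
  refine ⟨p, mem_diagCurve_of_notMem_exits hb hc hp ?_ ?_ hright hup, hpx⟩ <;> rintro rfl <;>
    obtain ⟨hx₀, hx₁⟩ := hx <;> simp only [mem_ofPred_eq] at hpx <;> linarith

theorem mapsTo_diagCurve (hb : b ∈ Ioc 0 1) (hc : c ∈ Ioc 0 1) :
    MapsTo (diagMap b c) (diagCurve b c) (diagCurve b c) := by
  intro p hp
  have hcurve := hp
  obtain ⟨-, hint⟩ := hp
  have hle := le_diagMap hb.1.le hc.1.le (interior_subset hint)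
  refine mem_diagCurve_of_notMem_exits hb hc
    (iterate_mem_baseSquare_of_mem_diagCurve hb hc hcurve 1) ?_
    (diagMap_ne_corner (abs_le_one_of_mem_Ioc hb) (abs_le_one_of_mem_Ioc hc) hint)
    (fun ⟨n, hn⟩ => notMem_exitsRight_of_mem_diagCurve hb hc hcurve ⟨n + 1, hn⟩)
    (fun ⟨n, hn⟩ => notMem_exitsUp_of_mem_diagCurve hb hc hcurve ⟨n + 1, hn⟩)
  rw [interior_baseSquare] at hint
  exact fun h => (hint.1.1.trans_le hle.1).ne' (congrArg Prod.fst h)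

theorem sub_fst_le_diagMap_sub_fst (hb : 0 ≤ b) (hp : p ∈ baseSquare) (hq : q ∈ baseSquare)
    (hu : q.1 ≤ p.1) (hv : p.2 ≤ q.2) :
    p.1 - q.1 ≤ (diagMap b c p).1 - (diagMap b c q).1 := by
  obtain ⟨⟨hpu₀, hpu₁⟩, hpv₀, -⟩ := hp
  obtain ⟨⟨hqu₀, -⟩, -, hqv₁⟩ := hq
  have hpi := pi_pos
  have hprod : sin q.1 * cos q.2 ≤ sin p.1 * cos p.2 :=
    mul_le_mul (sin_le_sin_of_le_of_le_pi_div_two (by linarith) hpu₁ hu)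
      (cos_le_cos_of_nonneg_of_le_pi hpv₀ (by linarith) hv)
      (cos_nonneg_of_mem_Icc ⟨by linarith, hqv₁⟩) (sin_nonneg_of_mem_Icc ⟨hpu₀, by linarith⟩)
  have := mul_le_mul_of_nonneg_left hprod hb
  simp only [diagMap]
  linarith

theorem sub_le_iterate_sub (hb : 0 ≤ b) (hc : 0 ≤ c) {n : ℕ}
    (hp : ∀ m < n, (diagMap b c)^[m] p ∈ baseSquare)
    (hq : ∀ m < n, (diagMap b c)^[m] q ∈ baseSquare) (hu : q.1 ≤ p.1) (hv : p.2 ≤ q.2) :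
    p.1 - q.1 ≤ ((diagMap b c)^[n] p).1 - ((diagMap b c)^[n] q).1 ∧
      q.2 - p.2 ≤ ((diagMap b c)^[n] q).2 - ((diagMap b c)^[n] p).2 := by
  induction n with
  | zero => exact ⟨le_rfl, le_rfl⟩
  | succ n ih =>
    obtain ⟨ihu, ihv⟩ := ih (fun m hm => hp m (by lia)) (fun m hm => hq m (by lia))
    have hu' := sub_nonneg.1 ((sub_nonneg.2 hu).trans ihu)
    have hv' := sub_nonneg.1 ((sub_nonneg.2 hv).trans ihv)
    have hpn := hp n n.lt_succ_self
    have hqn := hq n n.lt_succ_self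
    rw [Function.iterate_succ_apply', Function.iterate_succ_apply']
    exact ⟨ihu.trans (sub_fst_le_diagMap_sub_fst hb hpn hqn hu' hv'),
      ihv.trans (sub_fst_le_diagMap_sub_fst (c := b) hc (swap_mem_baseSquare.2 hqn)
        (swap_mem_baseSquare.2 hpn) hv' hu')⟩

theorem eq_of_mem_diagCurve_of_le (hb : b ∈ Ioc 0 1) (hc : c ∈ Ioc 0 1) (hp : p ∈ diagCurve b c)
    (hq : q ∈ diagCurve b c) (hu : q.1 ≤ p.1) (hv : p.2 ≤ q.2) : p = q := by
  have hgap := fun n => sub_le_iterate_sub (n := n) hb.1.le hc.1.le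
    (fun m _ => iterate_mem_baseSquare_of_mem_diagCurve hb hc hp m)
    (fun m _ => iterate_mem_baseSquare_of_mem_diagCurve hb hc hq m) hu hv
  have hp_lim : Tendsto (fun n => (diagMap b c)^[n] p) atTop (𝓝 (π / 2, π / 2)) := hp.1
  have hq_lim : Tendsto (fun n => (diagMap b c)^[n] q) atTop (𝓝 (π / 2, π / 2)) := hq.1
  have hu' := ge_of_tendsto' (hp_lim.fst_nhds.sub hq_lim.fst_nhds) fun n => (hgap n).1
  have hv' := ge_of_tendsto' (hq_lim.snd_nhds.sub hp_lim.snd_nhds) fun n => (hgap n).2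
  exact Prod.ext (by linarith) (by linarith)

/-! ### Orbits off the curve, and backward orbits -/

theorem mem_exitsRight_of_right_of_diagCurve (hb : b ∈ Ioc 0 1) (hc : c ∈ Ioc 0 1)
    (hp : p ∈ baseSquare) (hq : q ∈ diagCurve b c) (hu : q.1 < p.1) (hv : p.2 < q.2) :
    p ∈ exitsRight b c := by
  have hq_mem := iterate_mem_baseSquare_of_mem_diagCurve hb hc hq
  have hgap := fun (n : ℕ) (hn : ∀ m < n, (diagMap b c)^[m] p ∈ baseSquare) =>
    sub_le_iterate_sub hb.1.le hc.1.le hn (fun m _ => hq_mem m) hu.le hv.le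
  by_contra hright
  have hp_mem : ∀ n, (diagMap b c)^[n] p ∈ baseSquare := fun n => by
    induction n using Nat.strong_induction_on with
    | _ n ih =>
      refine iterate_mem_baseSquare_of_le hb hc hp (not_lt.1 fun h => hright ⟨n, h⟩) ?_
      linarith [(hgap n ih).2, (hq_mem n).2.2]
  have hq_lim : Tendsto (fun n => (diagMap b c)^[n] q) atTop (𝓝 (π / 2, π / 2)) := hq.1
  have hle : p.1 - q.1 ≤ π / 2 - π / 2 :=
    ge_of_tendsto' (tendsto_const_nhds.sub hq_lim.fst_nhds) fun n =>
      (hgap n fun m _ => hp_mem m).1.trans (sub_le_sub_right (hp_mem n).1.2 _)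
  linarith

theorem corner_notMem_exitsRight (b c : ℝ) : (π / 2, π / 2) ∉ exitsRight b c := by
  have hfixed : Function.IsFixedPt (diagMap b c) (π / 2, π / 2) := by
    simp only [Function.IsFixedPt, diagMap, cos_pi_div_two, mul_zero, add_zero]
  rintro ⟨n, hn⟩
  rw [hfixed.iterate n] at hn
  exact hn.false

theorem iterate_mem_exitsRight (hb : b ∈ Ioc 0 1) (hc : c ∈ Ioc 0 1) (hp : p ∈ baseSquare)
    (h : p ∈ exitsRight b c) (n : ℕ) : (diagMap b c)^[n] p ∈ exitsRight b c := by
  obtain ⟨m, hm⟩ := h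
  refine ⟨m, ?_⟩
  rw [← Function.iterate_add_apply]
  exact (iterate_mem_rightRegion hb hc hp (Nat.le_add_right m n) hm).1.1

theorem iterate_mem_rightSquare (hb : b ∈ Ioc 0 1) (hc : c ∈ Ioc 0 1) (hp : p ∈ baseSquare)
    (h : p ∈ exitsRight b c) {n : ℕ} (hn : π / 2 ≤ ((diagMap b c)^[n] p).1) :
    (diagMap b c)^[n] p ∈ rightSquare ∧ ((diagMap b c)^[n] p).2 < π / 2 := by
  rcases hn.lt_or_eq with hlt | heq
  · obtain ⟨hu, hv₀, hv₁⟩ := iterate_mem_rightRegion hb hc hp le_rfl hlt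
    exact ⟨⟨Ioc_subset_Icc_self hu, hv₀, hv₁.le⟩, hv₁⟩
  · have hup := notMem_exitsUp_of_mem_exitsRight hb hc hp h
    obtain ⟨-, hv₀, hv₁⟩ := iterate_mem_baseSquare_of_le hb hc hp heq.ge
      (not_lt.1 fun hlt => hup ⟨n, hlt⟩)
    refine ⟨⟨⟨hn, by linarith [pi_pos]⟩, hv₀, hv₁⟩, hv₁.lt_of_ne fun hv => ?_⟩
    have hcorner : (diagMap b c)^[n] p = (π / 2, π / 2) := Prod.ext heq.symm hv
    exact corner_notMem_exitsRight b c (hcorner ▸ iterate_mem_exitsRight hb hc hp h n)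

theorem leavesInto_rightSquare (hb : b ∈ Ioc 0 1) (hc : c ∈ Ioc 0 1) (hp : p ∈ baseSquare)
    (h : p ∈ exitsRight b c) : LeavesInto (diagMap b c) p baseSquare rightSquare := by
  classical
  have hup := notMem_exitsUp_of_mem_exitsRight hb hc hp h
  have hex : ∃ n, π / 2 ≤ ((diagMap b c)^[n] p).1 := h.imp fun _ => le_of_lt
  obtain ⟨hmem, hlt⟩ := iterate_mem_rightSquare hb hc hp h (Nat.find_spec hex)
  have hafter : ∀ n > Nat.find hex, (diagMap b c)^[n] p ∈ rightRegion := fun n hn => by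
    refine iterate_mem_rightRegion hb hc hp hn ?_
    rw [Function.iterate_succ_apply']
    exact (diagMap_mem_rightRegion hb hc hmem hlt).1.1
  refine ⟨Nat.find hex, fun n hn => ?_, fun n hn => ?_, fun n hn hn' => ?_⟩
  · have hn_lt := not_le.1 (Nat.find_min hex hn)
    exact ⟨iterate_mem_baseSquare_of_le hb hc hp hn_lt.le (not_lt.1 fun h => hup ⟨n, h⟩),
      fun hr => hn_lt.not_ge hr.1.1⟩
  · rcases hn.eq_or_lt with rfl | hlt
    · exact hmem
    · exact prod_mono Ioc_subset_Icc_self Ico_subset_Icc_self (hafter n hlt)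
  · exact (hafter n hn).1.1.not_ge hn'.1.2

theorem tendsto_zero_of_backward_orbit (hb : b ∈ Ioc 0 1) (hc : c ∈ Ioc 0 1) {X : ℕ → ℝ × ℝ}
    (hX : ∀ n, diagMap b c (X (n + 1)) = X n) (hX₀ : X 0 ∈ interior baseSquare) :
    Tendsto X atTop (𝓝 (0, 0)) := by
  have hint : ∀ n, X n ∈ interior baseSquare := fun n => by
    induction n with
    | zero => exact hX₀
    | succ n ih => exact preimage_interior_baseSquare_subset hb hc (by rwa [mem_preimage, hX])
  have hmem : ∀ n, X n ∈ baseSquare := fun n => interior_subset (hint n)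
  have hanti : Antitone X := antitone_nat_of_succ_le fun n =>
    (le_diagMap hb.1.le hc.1.le (hmem (n + 1))).trans_eq (hX n)
  obtain ⟨L, hL⟩ := exists_tendsto_of_antitone hanti
    ⟨(0, 0), by rintro _ ⟨n, rfl⟩; exact ⟨(hmem n).1.1, (hmem n).2.1⟩⟩
  have hfixed := isFixedPt_of_tendsto_backward_orbit (continuous_diagMap b c) hX hL
  have hLmem := isClosed_baseSquare.mem_of_tendsto hL (Eventually.of_forall hmem)
  rcases eq_of_isFixedPt hb.1 hc.1 hLmem hfixed with rfl | rfl
  · exact hL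
  · rw [interior_baseSquare] at hX₀
    exact absurd (hanti.le_of_tendsto hL 0).1 hX₀.1.2.not_ge

/-! ### Back to the original coordinates -/

/-- The diagonal coordinates `(x, y) ↦ ((x + y) / 2, (x - y) / 2)` on the plane. -/
def diagHomeo : ℝ × ℝ ≃ₜ ℝ × ℝ where
  toFun p := ((p.1 + p.2) / 2, (p.1 - p.2) / 2)
  invFun q := (q.1 + q.2, q.1 - q.2)
  left_inv p := by ext <;> simp only <;> ring
  right_inv q := by ext <;> simp only <;> ring
  continuous_toFun := by fun_prop
  continuous_invFun := by fun_prop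

theorem diagHomeo_apply (p : ℝ × ℝ) : diagHomeo p = ((p.1 + p.2) / 2, (p.1 - p.2) / 2) := rfl

theorem F_semiconj (a : ℝ) : Function.Semiconj diagHomeo (F a) (diagMap (3 * a) a) := by
  intro p
  have hx : sin p.1 = sin ((p.1 + p.2) / 2 + (p.1 - p.2) / 2) := by ring_nf
  have hy : sin p.2 = sin ((p.1 + p.2) / 2 - (p.1 - p.2) / 2) := by ring_nf
  simp only [diagHomeo_apply, F, diagMap, hx, hy, sin_add, sin_sub]
  ext <;> simp only <;> ring

theorem continuous_F (a : ℝ) : Continuous (F a) := by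
  unfold F
  fun_prop

theorem F_pi_mul (a : ℝ) (m n : ℤ) : F a (m * π, n * π) = (m * π, n * π) := by
  simp only [F, sin_int_mul_pi, mul_zero, add_zero]

theorem s₁_eq : s₁ = diagHomeo ⁻¹' baseSquare := by
  ext p
  simp only [s₁, baseSquare, diagHomeo_apply, mem_ofPred_eq, mem_preimage, mem_prod, mem_Icc]
  grind

theorem s₂_eq : s₂ = diagHomeo ⁻¹' rightSquare := by
  ext p
  simp only [s₂, rightSquare, diagHomeo_apply, mem_ofPred_eq, mem_preimage, mem_prod, mem_Icc]
  grind

theorem s₃_eq : s₃ = diagHomeo ⁻¹' (Prod.swap ⁻¹' rightSquare) := by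
  ext p
  simp only [s₃, rightSquare, diagHomeo_apply, mem_ofPred_eq, mem_preimage, mem_prod, mem_Icc,
    Prod.fst_swap, Prod.snd_swap]
  grind

theorem interior_s₁ : interior s₁ = diagHomeo ⁻¹' interior baseSquare := by
  rw [s₁_eq, diagHomeo.preimage_interior]

theorem γL_eq (a : ℝ) : γL a = diagHomeo ⁻¹' diagCurve (3 * a) a := by
  rw [γL, interior_s₁, stableSet_eq_preimage diagHomeo (F_semiconj a), diagHomeo_apply, diagCurve,
    preimage_inter, add_zero, sub_zero]

variable {a : ℝ}

theorem coupling_mem_Ioc (ha : 0 < a) (ha' : a ≤ 1 / 3) : 3 * a ∈ Ioc 0 1 ∧ a ∈ Ioc 0 1 :=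
  ⟨⟨by linarith, by linarith⟩, ha, by linarith⟩

theorem abs_snd_lt_of_mem_γL (hp : p ∈ γL a) : |p.2| < p.1 ∧ |p.2| < π - p.1 := by
  have hint := hp.2
  rw [interior_s₁, interior_baseSquare] at hint
  obtain ⟨⟨hu₀, hu₁⟩, hv₀, hv₁⟩ := hint
  simp only [diagHomeo_apply] at hu₀ hu₁ hv₀ hv₁
  simp only [abs_lt]
  refine ⟨⟨?_, ?_⟩, ?_, ?_⟩ <;> linarith

theorem fst_mem_Ioo_of_mem_γL (hp : p ∈ γL a) : p.1 ∈ Ioo 0 π := by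
  obtain ⟨hl, hr⟩ := abs_snd_lt_of_mem_γL hp
  exact ⟨(abs_nonneg _).trans_lt hl, sub_pos.1 ((abs_nonneg _).trans_lt hr)⟩

theorem abs_snd_sub_le_of_mem_γL (ha : 0 < a) (ha' : a ≤ 1 / 3) (hp : p ∈ γL a)
    (hq : q ∈ γL a) : |p.2 - q.2| ≤ |p.1 - q.1| := by
  obtain ⟨hb, hc⟩ := coupling_mem_Ioc ha ha'
  wlog hlt : q.2 ≤ p.2 generalizing p q
  · rw [abs_sub_comm p.2, abs_sub_comm p.1]
    exact this hq hp (le_of_not_ge hlt)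
  by_contra! h
  rw [abs_of_nonneg (sub_nonneg.2 hlt)] at h
  obtain ⟨hl, hr⟩ := abs_lt.1 h
  rw [γL_eq] at hp hq
  have heq : p = q := diagHomeo.injective <| eq_of_mem_diagCurve_of_le hb hc hp hq
    (by simp only [diagHomeo_apply]; linarith) (by simp only [diagHomeo_apply]; linarith)
  rw [heq, sub_self, sub_self] at hr
  exact hr.false

theorem injOn_fst_γL (ha : 0 < a) (ha' : a ≤ 1 / 3) : InjOn Prod.fst (γL a) := by
  intro p hp q hq h
  refine Prod.ext h (sub_eq_zero.1 (abs_nonpos_iff.1 ?_))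
  simpa only [h, sub_self, abs_zero] using abs_snd_sub_le_of_mem_γL ha ha' hp hq

theorem existsUnique_mem_γL (ha : 0 < a) (ha' : a ≤ 1 / 3) {x : ℝ} (hx : x ∈ Ioo 0 π) :
    ∃! y, (x, y) ∈ γL a := by
  obtain ⟨hb, hc⟩ := coupling_mem_Ioc ha ha'
  obtain ⟨p, hp, rfl⟩ := exists_mem_diagCurve_add_eq hb hc hx
  have hmem : (p.1 + p.2, p.1 - p.2) ∈ γL a := by
    rw [γL_eq, mem_preimage]
    exact (diagHomeo.apply_symm_apply p).symm ▸ hp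
  exact ⟨_, hmem, fun y hy => congrArg Prod.snd (injOn_fst_γL ha ha' hy hmem rfl)⟩

theorem exists_curve_γL (ha : 0 < a) (ha' : a ≤ 1 / 3) :
    ∃ c : ℝ → ℝ × ℝ, Continuous c ∧ Function.Injective c ∧ range c = γL a ∧
      Tendsto c atBot (𝓝 (0, 0)) ∧ Tendsto c atTop (𝓝 (π, 0)) := by
  choose! h hh using fun x hx => (existsUnique_mem_γL (x := x) ha ha' hx).exists
  have hcont : ContinuousOn h (Ioo 0 π) := LipschitzOnWith.continuousOn (K := 1) <|
    LipschitzOnWith.of_dist_le_mul fun x hx y hy => by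
      simpa only [NNReal.coe_one, one_mul, dist_eq] using
        abs_snd_sub_le_of_mem_γL ha ha' (hh x hx) (hh y hy)
  have hbounds : ∀ x ∈ Ioo 0 π, |h x| < x ∧ |h x| < π - x := fun x hx =>
    abs_snd_lt_of_mem_γL (hh x hx)
  have hl : Tendsto h (𝓝[>] 0) (𝓝 0) := squeeze_zero_norm'
    (eventually_of_mem (Ioo_mem_nhdsGT pi_pos) fun x hx => (hbounds x hx).1.le) nhdsWithin_le_nhds
  have hr : Tendsto h (𝓝[<] π) (𝓝 0) := by
    refine squeeze_zero_norm' (a := fun x => π - x)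
      (eventually_of_mem (Ioo_mem_nhdsLT pi_pos) fun x hx => (hbounds x hx).2.le) ?_
    simpa using (tendsto_id.const_sub π).mono_left (nhdsWithin_le_nhds (a := π) (s := Iio π))
  obtain ⟨c, hc, hinj, hrange, hbot, htop⟩ := exists_curve_range_eq_graph pi_pos hcont hl hr
  refine ⟨c, hc, hinj, hrange.trans (Subset.antisymm (image_subset_iff.2 hh) fun p hp => ?_),
    hbot, htop⟩
  have hx := fst_mem_Ioo_of_mem_γL hp
  exact ⟨p.1, hx, injOn_fst_γL ha ha' (hh p.1 hx) hp rfl⟩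

theorem image_γL (ha : 0 < a) (ha' : a ≤ 1 / 3) : F a '' γL a = γL a := by
  obtain ⟨hb, hc⟩ := coupling_mem_Ioc ha ha'
  obtain ⟨c, hcont, -, hrange, hbot, htop⟩ := exists_curve_γL ha ha'
  have hmaps : MapsTo (F a) (γL a) (γL a) := fun p hp => by
    rw [γL_eq, mem_preimage] at hp ⊢
    rw [(F_semiconj a).eq]
    exact mapsTo_diagCurve hb hc hp
  exact image_eq_of_mapsTo_of_curve (continuous_F a) (by simpa using F_pi_mul a 0 0)
    (by simpa using F_pi_mul a 1 0) hcont hrange hbot htop (injOn_fst_γL ha ha')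
    (fun _ => fst_mem_Ioo_of_mem_γL) hmaps

theorem preimage_interior_s₁_subset (ha : 0 < a) (ha' : a ≤ 1 / 3) :
    F a ⁻¹' interior s₁ ⊆ interior s₁ := by
  obtain ⟨hb, hc⟩ := coupling_mem_Ioc ha ha'
  rw [interior_s₁, ← preimage_comp, (F_semiconj a).comp_eq]
  exact preimage_mono (preimage_interior_baseSquare_subset hb hc)

theorem tendsto_orbit_of_mem_γL (ha : 0 < a) (ha' : a ≤ 1 / 3) {X : ℤ → ℝ × ℝ}
    (hX : ∀ n, X (n + 1) = F a (X n)) (hX₀ : X 0 ∈ γL a) :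
    Tendsto X atBot (𝓝 (0, 0)) ∧ Tendsto X atTop (𝓝 (π, 0)) := by
  obtain ⟨hb, hc⟩ := coupling_mem_Ioc ha ha'
  rw [tendsto_int_atTop_iff_nat, tendsto_int_atBot_iff_nat]
  constructor
  · have hback : ∀ n : ℕ, diagMap (3 * a) a (diagHomeo (X (-(n + 1 : ℕ)))) = diagHomeo (X (-n)) :=
      fun n => by
        rw [← (F_semiconj a).eq, ← hX, Nat.cast_succ, neg_add_rev, neg_add_cancel_comm]
    rw [diagHomeo.isInducing.tendsto_nhds_iff, diagHomeo_apply, add_zero, sub_zero, zero_div]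
    rw [γL_eq] at hX₀
    exact tendsto_zero_of_backward_orbit hb hc hback hX₀.2
  · simp only [orbit_natCast_eq_iterate hX]
    exact hX₀.1

theorem leavesInto_s₂_of_isAbove (ha : 0 < a) (ha' : a ≤ 1 / 3) (hp : p ∈ s₁)
    (h : IsAbove p (γL a)) : LeavesInto (F a) p s₁ s₂ := by
  obtain ⟨hb, hc⟩ := coupling_mem_Ioc ha ha'
  obtain ⟨y, hy, hlt⟩ := h
  rw [γL_eq] at hy
  rw [s₁_eq] at hp
  have hexits : diagHomeo p ∈ exitsRight (3 * a) a :=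
    mem_exitsRight_of_right_of_diagCurve hb hc hp hy
      (by simp only [diagHomeo_apply]; linarith) (by simp only [diagHomeo_apply]; linarith)
  rw [s₁_eq, s₂_eq]
  exact .of_semiconj (F_semiconj a) (leavesInto_rightSquare hb hc hp hexits)

theorem leavesInto_s₃_of_isBelow (ha : 0 < a) (ha' : a ≤ 1 / 3) (hp : p ∈ s₁)
    (h : IsBelow p (γL a)) : LeavesInto (F a) p s₁ s₃ := by
  obtain ⟨hb, hc⟩ := coupling_mem_Ioc ha ha'
  obtain ⟨y, hy, hlt⟩ := h
  rw [γL_eq] at hy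
  rw [s₁_eq] at hp
  have hp_swap := swap_mem_baseSquare.2 hp
  have hexits : (diagHomeo p).swap ∈ exitsRight a (3 * a) :=
    mem_exitsRight_of_right_of_diagCurve hc hb hp_swap (swap_mem_diagCurve.2 hy)
      (by simp only [diagHomeo_apply, Prod.fst_swap]; linarith)
      (by simp only [diagHomeo_apply, Prod.snd_swap]; linarith)
  have hswap : baseSquare = Prod.swap ⁻¹' baseSquare := ext fun _ => swap_mem_baseSquare.symm
  rw [s₁_eq, s₃_eq, hswap]
  exact .of_semiconj (F_semiconj a) <| .of_semiconj (diagMap_semiconj_swap _ _) <|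
    leavesInto_rightSquare hc hb hp_swap hexits

end

end ThreeClocks

theorem mainTheorem5_general (a : ℝ) (ha : 0 < a) (ha' : a ≤ 1 / 3) :
    ThreeClocks.IsHeteroclinicCurve (ThreeClocks.F a) (0, 0) (Real.pi, 0) (ThreeClocks.γL a) ∧
    (∀ x ∈ Set.Ioo 0 Real.pi, ∃! y, (x, y) ∈ ThreeClocks.γL a) ∧
    ThreeClocks.F a ⁻¹' interior ThreeClocks.s₁ ⊆ interior ThreeClocks.s₁ ∧
    (∀ p ∈ ThreeClocks.s₁, ThreeClocks.IsAbove p (ThreeClocks.γL a) →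
      ThreeClocks.LeavesInto (ThreeClocks.F a) p ThreeClocks.s₁ ThreeClocks.s₂) ∧
    (∀ p ∈ ThreeClocks.s₁, ThreeClocks.IsBelow p (ThreeClocks.γL a) →
      ThreeClocks.LeavesInto (ThreeClocks.F a) p ThreeClocks.s₁ ThreeClocks.s₃) := by
  open ThreeClocks in
  exact ⟨⟨exists_curve_γL ha ha', image_γL ha ha', fun _ => tendsto_orbit_of_mem_γL ha ha'⟩,
    fun _ => existsUnique_mem_γL ha ha', preimage_interior_s₁_subset ha ha',
    fun _ => leavesInto_s₂_of_isAbove ha ha', fun _ => leavesInto_s₃_of_isBelow ha ha'⟩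

theorem mainTheorem5 (a : ℝ) (ha : 0 < a) (ha' : a < 1 / 6) :
    -- `γL` is a heteroclinic curve from `(0,0)` to `(π,0)`, met exactly once by each vertical line
    ThreeClocks.IsHeteroclinicCurve (ThreeClocks.F a) (0, 0) (Real.pi, 0) (ThreeClocks.γL a) ∧
    (∀ x ∈ Set.Ioo 0 Real.pi, ∃! y, (x, y) ∈ ThreeClocks.γL a) ∧
    -- the interior of `s₁` is negatively invariant
    ThreeClocks.F a ⁻¹' interior ThreeClocks.s₁ ⊆ interior ThreeClocks.s₁ ∧
    -- orbits starting above `γL` cross into `s₂`, those starting below cross into `s₃`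
    (∀ p ∈ ThreeClocks.s₁, ThreeClocks.IsAbove p (ThreeClocks.γL a) →
      ThreeClocks.LeavesInto (ThreeClocks.F a) p ThreeClocks.s₁ ThreeClocks.s₂) ∧
    (∀ p ∈ ThreeClocks.s₁, ThreeClocks.IsBelow p (ThreeClocks.γL a) →
      ThreeClocks.LeavesInto (ThreeClocks.F a) p ThreeClocks.s₁ ThreeClocks.s₃) :=
  mainTheorem5_general a ha (by linarith)
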